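/- Let $\Theta\in\mathbb{R}^{3\times 3}$ be a symmetric matrix with $\Theta_{12}=\Theta_{23}=0$, and assume that $\Theta$ is indefinite, i.e. its quadratic form $v\mapsto v^\top\Theta v$ on $\mathbb{R}^3$ takes both positive and negative values. Let $\mathbb{C}_+=\{z\in\mathbb{C}:\operatorname{Im} z>0\}$ be the open upper half-plane with its hyperbolic metric, and let $$\mathcal{C}(\Theta)=\bigl\{x+\mathrm{j}y\in\mathbb{C}_+ : \Theta_{11}x^2+\Theta_{22}y^2+2\Theta_{13}x+\Theta_{33}\le 0\bigr\}.$$ Call a set $\mathcal{R}\subset\mathbb{C}_+$ hyperbolically convex if for every pair of points of $\mathcal{R}$ the hyperbolic geodesic segment connecting them lies in $\mathcal{R}$. Then $$\mathcal{C}(\Theta)\ \text{is hyperbolically convex}\quad\Longleftrightarrow\quad \Theta_{11}\ge\Theta_{22}.$$ -/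

import Mathlib

open scoped Matrix

namespace HConic

/-- A real square matrix is indefinite if its quadratic form takes both
positive and negative values. -/
def IsIndefinite {n : ℕ} (A : Matrix (Fin n) (Fin n) ℝ) : Prop :=
  (∃ v : Fin n → ℝ, 0 < v ⬝ᵥ (A *ᵥ v)) ∧ (∃ v : Fin n → ℝ, v ⬝ᵥ (A *ᵥ v) < 0)

/-- The vector `(Re z, Im z, 1)` attached to a point of the upper half-plane. -/
def augVec (z : UpperHalfPlane) : Fin 3 → ℝ := ![z.re, z.im, 1]

/-- The part of the conic region of `Θ` in the open upper half-plane. -/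
def conicRegion (Θ : Matrix (Fin 3) (Fin 3) ℝ) : Set UpperHalfPlane :=
  {z | augVec z ⬝ᵥ (Θ *ᵥ augVec z) ≤ 0}

/-- `γ`, restricted to `[0, dist z w]`, is a (unit speed, length minimizing) geodesic from `z`
to `w` for the hyperbolic distance of the upper half-plane. -/
def IsGeodesicFromTo (γ : ℝ → UpperHalfPlane) (z w : UpperHalfPlane) : Prop :=
  γ 0 = z ∧ γ (dist z w) = w ∧
    ∀ s ∈ Set.Icc 0 (dist z w), ∀ t ∈ Set.Icc 0 (dist z w), dist (γ s) (γ t) = |s - t|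

/-- The points of the hyperbolic geodesic connecting `z` and `w`. -/
def geodesicSegment (z w : UpperHalfPlane) : Set UpperHalfPlane :=
  {u | ∃ γ : ℝ → UpperHalfPlane, IsGeodesicFromTo γ z w ∧
    ∃ t ∈ Set.Icc 0 (dist z w), γ t = u}

/-- Hyperbolic convexity: the geodesic connecting any two points of the set lies in the set. -/
def HConvex (R : Set UpperHalfPlane) : Prop :=
  ∀ z ∈ R, ∀ w ∈ R, geodesicSegment z w ⊆ R

/-- The explicit inequality of the region of a symmetric `Θ` with `Θ₁₂ = Θ₂₃ = 0`. -/
theorem mem_conicRegion_iff {Θ : Matrix (Fin 3) (Fin 3) ℝ} (hΘ : Θ.IsSymm)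
    (h12 : Θ 0 1 = 0) (h23 : Θ 1 2 = 0) (z : UpperHalfPlane) :
    z ∈ conicRegion Θ ↔
      Θ 0 0 * z.re ^ 2 + Θ 1 1 * z.im ^ 2 + 2 * Θ 0 2 * z.re + Θ 2 2 ≤ 0 := by
  have h10 : Θ 1 0 = 0 := (hΘ.apply 0 1).trans h12
  have h21 : Θ 2 1 = 0 := (hΘ.apply 1 2).trans h23
  have h20 : Θ 2 0 = Θ 0 2 := hΘ.apply 0 2
  have key : augVec z ⬝ᵥ (Θ *ᵥ augVec z) =
      Θ 0 0 * z.re ^ 2 + Θ 1 1 * z.im ^ 2 + 2 * Θ 0 2 * z.re + Θ 2 2 := by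
    simp [augVec, dotProduct, Matrix.mulVec, Fin.sum_univ_three, h12, h23, h10, h21, h20]
    ring
  show augVec z ⬝ᵥ (Θ *ᵥ augVec z) ≤ 0 ↔ _
  rw [key]

end HConic

/-! Write `a, b, c, d` for `Θ 0 0, Θ 1 1, Θ 0 2, Θ 2 2`. In the coordinates `(x, x² + y²)`, a form
of the Klein model, geodesics are straight segments
(`exists_convexCombination_of_dist_add_dist_eq`). The defining function is affine in them minus `(a
- b) y²`, and `y² = (x² + y²) - x²` is concave. So for `b ≤ a` it is convex along geodesics, and its
sublevel set is convex. If `a < b` and the conic has a centre `m`, the function is `a (x - m)² + b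
y² + H`. On the semicircle of radius `√t` about `m` it tends to `H + a t` at the ideal ends and
equals `H + b t` at the top. Indefiniteness gives a `t` with `H + a t < 0 < H + b t`
(`exists_pos_separating`), which breaks convexity. The parabola, `a = 0 ≠ c`, has no centre and gets
an explicit semicircle. -/

open Real Filter Topology

namespace HConic

/-! ### Geodesics as Klein segments -/

/-- A lightlike vector of the form `(p, q, s) ↦ p * s - q ^ 2` that is orthogonal to a timelike
vector vanishes. -/
theorem lightlike_orthogonal_timelike_eq_zero {p q s P R S : ℝ} (hP : 0 < P) (hS : 0 < S)
    (hPS : P * S = R ^ 2 + 1) (hnull : p * s = q ^ 2) (horth : P * s + p * S = 2 * (R * q)) :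
    p = 0 ∧ q = 0 ∧ s = 0 := by
  have h4 : 4 * (R * q) ^ 2 = (P * s - p * S) ^ 2 + 4 * ((P * S) * (p * s)) := by
    linear_combination (-(P * s + p * S) - 2 * (R * q)) * horth
  rw [hPS, hnull] at h4
  have hq : q = 0 := by
    have : q ^ 2 ≤ 0 := by nlinarith [sq_nonneg (P * s - p * S)]
    exact pow_eq_zero_iff two_ne_zero |>.1 (le_antisymm this (sq_nonneg q))
  subst hq
  have h5 : P * s - p * S = 0 := by
    have : (P * s - p * S) ^ 2 = 0 := by linarith
    exact pow_eq_zero_iff two_ne_zero |>.1 this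
  have hs : P * s = 0 := by linarith
  have hp : p * S = 0 := by linarith
  exact ⟨(mul_eq_zero.1 hp).resolve_right hS.ne', rfl, (mul_eq_zero.1 hs).resolve_left hP.ne'⟩

/-- `cosh (dist z w)` as the bilinear form of the hyperboloid model. -/
theorem cosh_dist_eq_bilinear (z w : UpperHalfPlane) :
    2 * cosh (dist z w) = (z.re ^ 2 + z.im ^ 2) / z.im * (1 / w.im) +
      1 / z.im * ((w.re ^ 2 + w.im ^ 2) / w.im) - 2 * (z.re / z.im * (w.re / w.im)) := by
  have hz := z.im_pos.ne'
  have hw := w.im_pos.ne'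
  rw [UpperHalfPlane.cosh_dist']
  field_simp
  ring

/-- A point between `z` and `w` is a convex combination of them in the Klein model. -/
theorem exists_convexCombination_of_dist_add_dist_eq {z u w : UpperHalfPlane}
    (h : dist z u + dist u w = dist z w) :
    ∃ α β : ℝ, 0 ≤ α ∧ 0 ≤ β ∧ α + β = 1 ∧ u.re = α * z.re + β * w.re ∧
      u.re ^ 2 + u.im ^ 2 = α * (z.re ^ 2 + z.im ^ 2) + β * (w.re ^ 2 + w.im ^ 2) := by
  have hz := z.im_pos
  have hu := u.im_pos
  have hw := w.im_pos
  have hA : 0 ≤ dist z u := dist_nonneg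
  have hB : 0 ≤ dist u w := dist_nonneg
  rcases (add_nonneg hA hB).eq_or_lt with h0 | h0
  · have hzu : z = u := dist_eq_zero.1 (by linarith)
    subst hzu
    exact ⟨1, 0, zero_le_one, le_rfl, by ring, by ring, by ring⟩
  have eA := cosh_dist_eq_bilinear z u
  have eB := cosh_dist_eq_bilinear u w
  have eC := cosh_dist_eq_bilinear z w
  rw [← h, cosh_add] at eC
  have hC : 0 < sinh (dist z u + dist u w) := sinh_pos_iff.2 h0
  have hsA : 0 ≤ sinh (dist z u) := sinh_nonneg_iff.2 hA
  have hsB : 0 ≤ sinh (dist u w) := sinh_nonneg_iff.2 hB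
  have cA := cosh_sq (dist z u)
  have cB := cosh_sq (dist u w)
  rw [sinh_add] at hC
  generalize sinh (dist z u) = a at *
  generalize sinh (dist u w) = b at *
  generalize cosh (dist z u) = A at *
  generalize cosh (dist u w) = B at *
  have dz : (z.re ^ 2 + z.im ^ 2) / z.im * (1 / z.im) = (z.re / z.im) ^ 2 + 1 := by field_simp
  have du : (u.re ^ 2 + u.im ^ 2) / u.im * (1 / u.im) = (u.re / u.im) ^ 2 + 1 := by field_simp
  have dw : (w.re ^ 2 + w.im ^ 2) / w.im * (1 / w.im) = (w.re / w.im) ^ 2 + 1 := by field_simp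
  have hPu : 0 < (u.re ^ 2 + u.im ^ 2) / u.im := by positivity
  have hSu : 0 < 1 / u.im := by positivity
  -- For hyperboloid vectors `Z, U, W`, the combination `b Z + a W - sinh (dist z u + dist u w) U`
  -- is null and orthogonal to the timelike `U`, so it vanishes.
  obtain ⟨h1, h2, h3⟩ := lightlike_orthogonal_timelike_eq_zero (R := u.re / u.im)
    (p := b * ((z.re ^ 2 + z.im ^ 2) / z.im) + a * ((w.re ^ 2 + w.im ^ 2) / w.im)
      - (a * B + A * b) * ((u.re ^ 2 + u.im ^ 2) / u.im))
    (q := b * (z.re / z.im) + a * (w.re / w.im) - (a * B + A * b) * (u.re / u.im))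
    (s := b * (1 / z.im) + a * (1 / w.im) - (a * B + A * b) * (1 / u.im))
    hPu hSu du
    (by
      generalize (z.re ^ 2 + z.im ^ 2) / z.im = P₁ at *
      generalize (u.re ^ 2 + u.im ^ 2) / u.im = P₂ at *
      generalize (w.re ^ 2 + w.im ^ 2) / w.im = P₃ at *
      generalize z.re / z.im = R₁ at *
      generalize u.re / u.im = R₂ at *
      generalize w.re / w.im = R₃ at *
      generalize 1 / z.im = S₁ at *
      generalize 1 / u.im = S₂ at *
      generalize 1 / w.im = S₃ at *
      linear_combination b ^ 2 * dz + a ^ 2 * dw + (a * B + A * b) ^ 2 * du - a * b * eC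
        + (a * B + A * b) * (b * eA + a * eB) - b ^ 2 * cA - a ^ 2 * cB)
    (by
      generalize (z.re ^ 2 + z.im ^ 2) / z.im = P₁ at *
      generalize (u.re ^ 2 + u.im ^ 2) / u.im = P₂ at *
      generalize (w.re ^ 2 + w.im ^ 2) / w.im = P₃ at *
      generalize z.re / z.im = R₁ at *
      generalize u.re / u.im = R₂ at *
      generalize w.re / w.im = R₃ at *
      generalize 1 / z.im = S₁ at *
      generalize 1 / u.im = S₂ at *
      generalize 1 / w.im = S₃ at *
      linear_combination -b * eA - a * eB - 2 * (a * B + A * b) * du)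
  generalize hc : a * B + A * b = c at hC h1 h2 h3
  -- The factors `u.im / z.im` and `u.im / w.im` rescale the coordinate `1 / im` of each vector to
  -- `1`.
  refine ⟨b / c * (u.im / z.im), a / c * (u.im / w.im),
    by positivity, by positivity, ?_, ?_, ?_⟩
  · field_simp at h3 ⊢
    linear_combination h3
  · field_simp at h2 ⊢
    linear_combination -h2
  · field_simp at h1 ⊢
    linear_combination -h1

theorem dist_add_dist_of_mem_geodesicSegment {z w u : UpperHalfPlane}
    (hu : u ∈ geodesicSegment z w) : dist z u + dist u w = dist z w := by
  obtain ⟨γ, ⟨h0, h1, hγ⟩, t, ht, rfl⟩ := hu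
  have hd : (0 : ℝ) ≤ dist z w := dist_nonneg
  have e1 := hγ 0 ⟨le_rfl, hd⟩ t ht
  have e2 := hγ t ht (dist z w) ⟨hd, le_rfl⟩
  rw [h0, abs_of_nonpos (by linarith [ht.1])] at e1
  rw [h1, abs_of_nonpos (by linarith [ht.2])] at e2
  linarith

/-! ### Semicircles as geodesics -/

/-- The unit speed parametrization of the geodesic with ideal endpoints `m - r` and `m + r`. -/
noncomputable def semicircle (m r : ℝ) (hr : 0 < r) (t : ℝ) : UpperHalfPlane :=
  ⟨⟨m + r * tanh t, r / cosh t⟩, div_pos hr (cosh_pos t)⟩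

theorem semicircle_re (m r : ℝ) (hr : 0 < r) (t : ℝ) :
    (semicircle m r hr t).re = m + r * tanh t := rfl

theorem semicircle_im (m r : ℝ) (hr : 0 < r) (t : ℝ) :
    (semicircle m r hr t).im = r / cosh t := rfl

theorem dist_semicircle (m r : ℝ) (hr : 0 < r) (s t : ℝ) :
    dist (semicircle m r hr s) (semicircle m r hr t) = |s - t| := by
  have key : cosh (dist (semicircle m r hr s) (semicircle m r hr t)) = cosh (s - t) := by
    rw [UpperHalfPlane.cosh_dist']
    simp only [semicircle_re, semicircle_im, tanh_eq_sinh_div_cosh, cosh_sub]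
    have hs := cosh_sq s
    have ht := cosh_sq t
    have hs0 := (cosh_pos s).ne'
    have ht0 := (cosh_pos t).ne'
    field_simp
    linear_combination (-r ^ 2 * cosh t ^ 2) * hs - r ^ 2 * cosh s ^ 2 * ht
  rwa [← cosh_abs (s - t), cosh_strictMonoOn.injOn.eq_iff (Set.mem_Ici.2 dist_nonneg)
    (Set.mem_Ici.2 (abs_nonneg _))] at key

theorem semicircle_zero_mem_geodesicSegment (m r : ℝ) (hr : 0 < r) {T : ℝ} (hT : 0 ≤ T) :
    semicircle m r hr 0 ∈ geodesicSegment (semicircle m r hr (-T)) (semicircle m r hr T) := by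
  have hd : dist (semicircle m r hr (-T)) (semicircle m r hr T) = 2 * T := by
    rw [dist_semicircle, abs_of_nonpos (by linarith)]
    ring
  refine ⟨fun t => semicircle m r hr (t - T), ⟨?_, ?_, fun s _ t _ => ?_⟩, T, ⟨hT, ?_⟩, ?_⟩
  · beta_reduce
    rw [zero_sub]
  · beta_reduce
    rw [hd, two_mul, add_sub_cancel_right]
  · rw [dist_semicircle, sub_sub_sub_cancel_right]
  · rw [hd]
    linarith
  · beta_reduce
    rw [sub_self]

/-- Parametrizing by relative height `y` turns the limit at the ideal ends into continuity at `y =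
0`. -/
theorem exists_tanh_eq_cosh_eq {y : ℝ} (hy : 0 < y) (hy1 : y ≤ 1) :
    ∃ T, 0 ≤ T ∧ tanh T = √(1 - y ^ 2) ∧ cosh T = 1 / y := by
  have h1 : 1 ≤ 1 / y := by rwa [le_div_iff₀ hy, one_mul]
  have hc := cosh_arcosh h1
  have h0 : 0 ≤ arcosh (1 / y) := arcosh_nonneg h1
  refine ⟨_, h0, ?_, hc⟩
  rw [eq_comm, sqrt_eq_iff_eq_sq (by nlinarith)
    (by rw [tanh_eq_sinh_div_cosh]
        exact div_nonneg (sinh_nonneg_iff.2 h0) (cosh_pos _).le),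
    tanh_eq_sinh_div_cosh, div_pow, sinh_sq, hc]
  field_simp

/-- A conic region that contains neighbourhoods of the ideal endpoints of a geodesic but not its
top point is not hyperbolically convex. -/
theorem not_hConvex_of_semicircle {Θ : Matrix (Fin 3) (Fin 3) ℝ} (hsymm : Θ.IsSymm)
    (h12 : Θ 0 1 = 0) (h23 : Θ 1 2 = 0) {m r : ℝ} (hr : 0 < r)
    (hleft : Θ 0 0 * (m - r) ^ 2 + 2 * Θ 0 2 * (m - r) + Θ 2 2 < 0)
    (hright : Θ 0 0 * (m + r) ^ 2 + 2 * Θ 0 2 * (m + r) + Θ 2 2 < 0)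
    (htop : 0 < Θ 0 0 * m ^ 2 + Θ 1 1 * r ^ 2 + 2 * Θ 0 2 * m + Θ 2 2) :
    ¬ HConvex (conicRegion Θ) := by
  intro hconv
  have near : ∀ ε : ℝ,
      Θ 0 0 * (m + r * ε) ^ 2 + 2 * Θ 0 2 * (m + r * ε) + Θ 2 2 < 0 →
      ∀ᶠ y in 𝓝[>] (0 : ℝ), Θ 0 0 * (m + r * (ε * √(1 - y ^ 2))) ^ 2 + Θ 1 1 * (r * y) ^ 2
        + 2 * Θ 0 2 * (m + r * (ε * √(1 - y ^ 2))) + Θ 2 2 < 0 := by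
    intro ε hε
    have hcont : Continuous fun y : ℝ => Θ 0 0 * (m + r * (ε * √(1 - y ^ 2))) ^ 2
        + Θ 1 1 * (r * y) ^ 2 + 2 * Θ 0 2 * (m + r * (ε * √(1 - y ^ 2))) + Θ 2 2 := by fun_prop
    refine nhdsWithin_le_nhds (hcont.continuousAt.eventually_lt_const ?_)
    simpa using hε
  obtain ⟨y, ⟨h1, h2⟩, hy0, hy1⟩ := (((near (-1) (by simpa [sub_eq_add_neg] using hleft)).and
    (near 1 (by simpa using hright))).and (Ioc_mem_nhdsGT zero_lt_one)).exists
  obtain ⟨T, hT, htanh, hcosh⟩ := exists_tanh_eq_cosh_eq hy0 hy1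
  have hmem := hconv (semicircle m r hr (-T)) ?_ (semicircle m r hr T) ?_
    (semicircle_zero_mem_geodesicSegment m r hr hT)
  · rw [mem_conicRegion_iff hsymm h12 h23, semicircle_re, semicircle_im] at hmem
    simp only [tanh_zero, cosh_zero, mul_zero, add_zero, div_one] at hmem
    linarith
  · rw [mem_conicRegion_iff hsymm h12 h23, semicircle_re, semicircle_im, tanh_neg, cosh_neg,
      htanh, hcosh, div_div_eq_mul_div, div_one]
    simpa using h1.le
  · rw [mem_conicRegion_iff hsymm h12 h23, semicircle_re, semicircle_im,
      htanh, hcosh, div_div_eq_mul_div, div_one]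
    simpa using h2.le

/-! ### Sufficiency -/

theorem hConvex_conicRegion_of_le {Θ : Matrix (Fin 3) (Fin 3) ℝ} (hsymm : Θ.IsSymm)
    (h12 : Θ 0 1 = 0) (h23 : Θ 1 2 = 0) (hle : Θ 1 1 ≤ Θ 0 0) : HConvex (conicRegion Θ) := by
  intro z hz w hw u hu
  obtain ⟨α, β, hα, hβ, hαβ, hre, hnorm⟩ :=
    exists_convexCombination_of_dist_add_dist_eq (dist_add_dist_of_mem_geodesicSegment hu)
  rw [mem_conicRegion_iff hsymm h12 h23] at hz hw ⊢
  have him : α * z.im ^ 2 + β * w.im ^ 2 ≤ u.im ^ 2 := by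
    have : u.im ^ 2 - (α * z.im ^ 2 + β * w.im ^ 2) = α * β * (z.re - w.re) ^ 2 := by
      rw [hre] at hnorm
      obtain rfl : β = 1 - α := by linarith
      linear_combination hnorm
    have : 0 ≤ α * β * (z.re - w.re) ^ 2 := by positivity
    linarith
  have h1 := mul_le_mul_of_nonneg_left him (sub_nonneg.2 hle)
  have h2 := mul_nonpos_of_nonneg_of_nonpos hα hz
  have h3 := mul_nonpos_of_nonneg_of_nonpos hβ hw
  have h4 : Θ 0 0 * u.re ^ 2 + Θ 1 1 * u.im ^ 2 + 2 * Θ 0 2 * u.re + Θ 2 2 =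
      Θ 0 0 * (u.re ^ 2 + u.im ^ 2) - (Θ 0 0 - Θ 1 1) * u.im ^ 2 + 2 * Θ 0 2 * u.re
        + Θ 2 2 * (α + β) := by
    rw [hαβ]
    ring
  rw [h4, hnorm, hre]
  linarith

/-! ### Necessity -/

theorem quadraticForm_eq {Θ : Matrix (Fin 3) (Fin 3) ℝ} (hsymm : Θ.IsSymm)
    (h12 : Θ 0 1 = 0) (h23 : Θ 1 2 = 0) (v : Fin 3 → ℝ) :
    v ⬝ᵥ (Θ *ᵥ v) = Θ 0 0 * v 0 ^ 2 + Θ 1 1 * v 1 ^ 2 + 2 * Θ 0 2 * (v 0 * v 2)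
      + Θ 2 2 * v 2 ^ 2 := by
  have h10 : Θ 1 0 = 0 := (hsymm.apply 0 1).trans h12
  have h21 : Θ 2 1 = 0 := (hsymm.apply 1 2).trans h23
  have h20 : Θ 2 0 = Θ 0 2 := hsymm.apply 0 2
  simp [dotProduct, Matrix.mulVec, Fin.sum_univ_three, h12, h23, h10, h21, h20]
  ring

/-- Two affine functions of `t`, with slopes `a < b` and common value `H` at `0`, are separated
in sign at some positive `t` unless they are semidefinite together. -/
theorem exists_pos_separating {a b H : ℝ} (hab : a < b)
    (hpos : 0 < a ∨ 0 < b ∨ 0 < H) (hneg : a < 0 ∨ b < 0 ∨ H < 0) :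
    ∃ t : ℝ, 0 < t ∧ H + a * t < 0 ∧ 0 < H + b * t := by
  rcases lt_or_ge 0 b with hb | hb
  · rcases lt_or_ge a 0 with ha | ha
    · have hp : 0 ≤ |H| / b := by positivity
      have hq : 0 ≤ |H| / -a := div_nonneg (abs_nonneg H) (by linarith)
      have hpb : b * (|H| / b) = |H| := by field_simp
      have hqa : -a * (|H| / -a) = |H| := mul_div_cancel₀ _ (by linarith)
      -- Larger than both thresholds `|H| / b` and `|H| / -a`.
      refine ⟨|H| / b + |H| / -a + 1, by positivity, ?_, ?_⟩
      · have : 0 ≤ -a * (|H| / b) := mul_nonneg (by linarith) hp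
        linarith [le_abs_self H]
      · have : 0 ≤ b * (|H| / -a) := mul_nonneg hb.le hq
        linarith [neg_abs_le H]
    · have hH : H < 0 := by
        rcases hneg with h | h | h <;> linarith
      -- The zero of the affine function with the mean slope, which lies strictly between the two
      -- for `t > 0`.
      refine ⟨-H / ((a + b) / 2), div_pos (by linarith) (by linarith), ?_, ?_⟩
      · have : a * (-H / ((a + b) / 2)) < -H := by
          rw [mul_div_assoc', div_lt_iff₀ (by linarith)]
          nlinarith
        linarith
      · have : -H < b * (-H / ((a + b) / 2)) := by
          rw [mul_div_assoc', lt_div_iff₀ (by linarith)]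
          nlinarith
        linarith
  · have hH : 0 < H := by
      rcases hpos with h | h | h <;> linarith
    have hs : 0 < -(a + b) / 2 := by linarith
    refine ⟨H / (-(a + b) / 2), div_pos hH hs, ?_, ?_⟩
    · have : H < -a * (H / (-(a + b) / 2)) := by
        rw [mul_div_assoc', lt_div_iff₀ hs]
        nlinarith
      linarith
    · have : -b * (H / (-(a + b) / 2)) < H := by
        rw [mul_div_assoc', div_lt_iff₀ hs]
        nlinarith
      linarith

theorem not_hConvex_of_lt {Θ : Matrix (Fin 3) (Fin 3) ℝ} (hsymm : Θ.IsSymm)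
    (h12 : Θ 0 1 = 0) (h23 : Θ 1 2 = 0) (hindef : IsIndefinite Θ) (hlt : Θ 0 0 < Θ 1 1) :
    ¬ HConvex (conicRegion Θ) := by
  by_cases hdeg : Θ 0 0 = 0 ∧ Θ 0 2 ≠ 0
  -- Parabola with vertex `x₀ = -d / (2c)`: at `x₀ - k c / b` the linear part is `-2 k c² / b`.
  -- Centre `k = 5` and radius `4 |c| / b` put the ends at `k = 1, 9`, and the top value is `(16 -
  -- 10) c² / b > 0`.
  · obtain ⟨ha, hc⟩ := hdeg
    have hb : 0 < Θ 1 1 := ha ▸ hlt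
    have hc2 : 0 < Θ 0 2 ^ 2 := by positivity
    have hb' := hb.ne'
    have hr : 0 < 4 * |Θ 0 2| / Θ 1 1 := by positivity
    have hval : ∀ k : ℝ, 0 < k →
        2 * Θ 0 2 * (-Θ 2 2 / (2 * Θ 0 2) - k * Θ 0 2 / Θ 1 1) + Θ 2 2 < 0 := by
      intro k hk
      have : 2 * Θ 0 2 * (-Θ 2 2 / (2 * Θ 0 2) - k * Θ 0 2 / Θ 1 1) + Θ 2 2
          = -(2 * k * Θ 0 2 ^ 2 / Θ 1 1) := by
        field_simp
        ring
      rw [this]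
      have : 0 < 2 * k * Θ 0 2 ^ 2 / Θ 1 1 := by positivity
      linarith
    have hnear : -Θ 2 2 / (2 * Θ 0 2) - 5 * Θ 0 2 / Θ 1 1 + 4 * Θ 0 2 / Θ 1 1
        = -Θ 2 2 / (2 * Θ 0 2) - 1 * Θ 0 2 / Θ 1 1 := by ring
    have hfar : -Θ 2 2 / (2 * Θ 0 2) - 5 * Θ 0 2 / Θ 1 1 - 4 * Θ 0 2 / Θ 1 1
        = -Θ 2 2 / (2 * Θ 0 2) - 9 * Θ 0 2 / Θ 1 1 := by ring
    have hflip : 4 * -Θ 0 2 / Θ 1 1 = -(4 * Θ 0 2 / Θ 1 1) := by ring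
    have h1 := hval 1 one_pos
    have h9 := hval 9 (by norm_num)
    rw [← hnear] at h1
    rw [← hfar] at h9
    refine not_hConvex_of_semicircle hsymm h12 h23 (m := -Θ 2 2 / (2 * Θ 0 2) - 5 * Θ 0 2 / Θ 1 1)
      hr ?_ ?_ ?_
    · rw [ha, zero_mul, zero_add]
      rcases abs_choice (Θ 0 2) with h | h <;> rw [h]
      · exact h9
      · rw [hflip, sub_neg_eq_add]
        exact h1
    · rw [ha, zero_mul, zero_add]
      rcases abs_choice (Θ 0 2) with h | h <;> rw [h]
      · exact h1
      · rw [hflip, ← sub_eq_add_neg]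
        exact h9
    · have : Θ 0 0 * (-Θ 2 2 / (2 * Θ 0 2) - 5 * Θ 0 2 / Θ 1 1) ^ 2
          + Θ 1 1 * (4 * |Θ 0 2| / Θ 1 1) ^ 2
          + 2 * Θ 0 2 * (-Θ 2 2 / (2 * Θ 0 2) - 5 * Θ 0 2 / Θ 1 1) + Θ 2 2
          = 6 * Θ 0 2 ^ 2 / Θ 1 1 := by
        rw [ha, div_pow, mul_pow, sq_abs]
        field_simp
        ring
      rw [this]
      positivity
  obtain ⟨m, hm⟩ : ∃ m, Θ 0 2 = -(Θ 0 0 * m) := by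
    by_cases ha : Θ 0 0 = 0
    -- Here `c = 0` as well, so any `m` would do.
    · exact ⟨0, by simpa [ha] using hdeg⟩
    · exact ⟨-Θ 0 2 / Θ 0 0, by field_simp⟩
  obtain ⟨⟨v, hv⟩, ⟨w, hw⟩⟩ := hindef
  rw [quadraticForm_eq hsymm h12 h23, hm] at hv hw
  have diag : ∀ v : Fin 3 → ℝ, Θ 0 0 * v 0 ^ 2 + Θ 1 1 * v 1 ^ 2
      + 2 * -(Θ 0 0 * m) * (v 0 * v 2) + Θ 2 2 * v 2 ^ 2 =
      Θ 0 0 * (v 0 - m * v 2) ^ 2 + Θ 1 1 * v 1 ^ 2 + (Θ 2 2 - Θ 0 0 * m ^ 2) * v 2 ^ 2 :=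
    fun v => by ring
  rw [diag] at hv hw
  obtain ⟨t, ht, hlow, hhigh⟩ := exists_pos_separating (H := Θ 2 2 - Θ 0 0 * m ^ 2) hlt
    (by
      by_contra! hcon
      obtain ⟨h1, h2, h3⟩ := hcon
      linarith [mul_nonpos_of_nonpos_of_nonneg h1 (sq_nonneg (v 0 - m * v 2)),
        mul_nonpos_of_nonpos_of_nonneg h2 (sq_nonneg (v 1)),
        mul_nonpos_of_nonpos_of_nonneg h3 (sq_nonneg (v 2))])
    (by
      by_contra! hcon
      obtain ⟨h1, h2, h3⟩ := hcon
      linarith [mul_nonneg h1 (sq_nonneg (w 0 - m * w 2)), mul_nonneg h2 (sq_nonneg (w 1)),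
        mul_nonneg h3 (sq_nonneg (w 2))])
  have hsq := sq_sqrt ht.le
  refine not_hConvex_of_semicircle hsymm h12 h23 (m := m) (sqrt_pos.2 ht) ?_ ?_ ?_
  · rw [hm]
    linear_combination hlow + Θ 0 0 * hsq
  · rw [hm]
    linear_combination hlow + Θ 0 0 * hsq
  · rw [hm, hsq]
    linear_combination hhigh

end HConic

theorem mainTheorem2 (Θ : Matrix (Fin 3) (Fin 3) ℝ) (hsymm : Θ.IsSymm)
    (h12 : Θ 0 1 = 0) (h23 : Θ 1 2 = 0) (hindef : HConic.IsIndefinite Θ) :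
    HConic.HConvex (HConic.conicRegion Θ) ↔ Θ 1 1 ≤ Θ 0 0 :=
  ⟨fun h => not_lt.1 fun hlt => HConic.not_hConvex_of_lt hsymm h12 h23 hindef hlt h,
    HConic.hConvex_conicRegion_of_le hsymm h12 h23⟩
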